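/- For $\tau$ in the upper half plane $\mathbb{H}$ put $q=e^{2\pi i\tau}$ and $q^{1/4}=e^{2\pi i\tau/4}$, let \[ X(\tau)=q^{1/4}\prod_{n=1}^{\infty}\frac{(1-q^{6n-1})(1-q^{6n-5})}{(1-q^{6n-2})(1-q^{6n-4})} \] be the continued fraction of order six (in its product form), and let $w(\tau)=X(\tau)X(3\tau)$. For $n\ge 1$, a modular equation of level $n$ for $w$ is a relation $F(w(\tau),w(n\tau))=0$, valid for all $\tau\in\mathbb{H}$, with $F\in\mathbb{C}[X,Y]$ irreducible. **Theorem (modular equation of level three).** For all $\tau\in\mathbb{H}$, \[ \begin{aligned} w(\tau)^3-w(3\tau)&+3w(\tau)w(3\tau)-3w(\tau)^2w(3\tau)+3w(3\tau)^2-9w(\tau)w(3\tau)^2\\ &+9w(\tau)^2w(3\tau)^2-3w(3\tau)^3+9w(\tau)w(3\tau)^3-9w(\tau)^2w(3\tau)^3=0. \end{aligned} \] This is a modular equation of level three for $w$: the polynomial \[ F_3(X,Y)=X^3-Y+3XY-3X^2Y+3Y^2-9XY^2+9X^2Y^2-3Y^3+9XY^3-9X^2Y^3\in\mathbb{Z}[X,Y]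 \] is irreducible in $\mathbb{C}[X,Y]$, has degree $3$ in $X$ and degree $3$ in $Y$, and satisfies $F_3(w(\tau),w(3\tau))=0$ for all $\tau\in\mathbb{H}$. -/

import Mathlib

open Complex UpperHalfPlane

/-- The nome `q = exp (2 π i τ)`. -/
noncomputable def nome (τ : ℂ) : ℂ := Complex.exp (2 * Real.pi * Complex.I * τ)

/-- The `n`-th factor of the product defining the continued fraction of order six. The index is
shifted to start at `0`: with `m = n + 1` the exponents are `6m - 1`, `6m - 5`, `6m - 2`,
`6m - 4`. -/
noncomputable def sixFactor (n : ℕ) (τ : ℂ) : ℂ :=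
  ((1 - nome τ ^ (6 * n + 5)) * (1 - nome τ ^ (6 * n + 1))) /
    ((1 - nome τ ^ (6 * n + 4)) * (1 - nome τ ^ (6 * n + 2)))

/-- The continued fraction of order six, as a function on the upper half plane, through its
product expansion; the leading factor is `q ^ (1 / 4) = exp (2 π i τ / 4)`. -/
noncomputable def contFracSix (τ : ℂ) : ℂ :=
  Complex.exp (2 * Real.pi * Complex.I * τ / 4) * ∏' n : ℕ, sixFactor n τ

/-- The function `w(τ) = X(τ) X(3τ)`, where `X` is the continued fraction of order six. -/
noncomputable def wFun (τ : ℂ) : ℂ := contFracSix τ * contFracSix (3 * τ)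

/-- `F(X, Y) = 0` is a modular equation of level `n` for `f`: the polynomial `F` is irreducible
over `ℂ` and `F(f(τ), f(nτ)) = 0` on the upper half plane. Variable `0` is `X`, variable `1`
is `Y`. -/
def IsModularEquation (f : ℂ → ℂ) (n : ℕ) (F : MvPolynomial (Fin 2) ℂ) : Prop :=
  Irreducible F ∧ ∀ τ : ℍ, MvPolynomial.eval ![f (τ : ℂ), f ((n : ℂ) * (τ : ℂ))] F = 0

/-- `X³ - Y + 3XY - 3X²Y + 3Y² - 9XY² + 9X²Y² - 3Y³ + 9XY³ - 9X²Y³`, with integer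
coefficients; `X` is variable `0` and `Y` is variable `1`. -/
noncomputable def levelThreePoly : MvPolynomial (Fin 2) ℤ :=
  let x : MvPolynomial (Fin 2) ℤ := MvPolynomial.X 0
  let y : MvPolynomial (Fin 2) ℤ := MvPolynomial.X 1
  x ^ 3 - y + 3 * x * y - 3 * x ^ 2 * y + 3 * y ^ 2 - 9 * x * y ^ 2 + 9 * x ^ 2 * y ^ 2
    - 3 * y ^ 3 + 9 * x * y ^ 3 - 9 * x ^ 2 * y ^ 3

/-! Write `E(q)` for the Euler product. The infinite product in `X` is `E(q) E(q⁶)² / (E(q²)²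
E(q³))`, so in `X(τ) X(3τ)` the factors at `q³` and `q⁶` cancel. Gauss's identity `ψ(q) = E(q²)² /
E(q)` then gives `w(τ) = q ψ(q⁹) / ψ(q)` (`wFun_mul_thetaPsi`).

The key relation is `thetaPsi_cubic`. Splitting triangular exponents mod 3 gives `ψ(q) = A + q
ψ(q⁹)`, where `A` is invariant under `q ↦ ωq` for `ω³ = 1`. Multiplying over the three rotations
gives `A³ + q³ ψ(q⁹)³`, while the product formula for `ψ` evaluates the same product as `ψ(q³)⁴ /
ψ(q⁹)`. Since `(1 - w)³ + w³ = 1 - 3w + 3w²`, this reads `ψ(q)³ ψ(q⁹) (1 - 3w + 3w²) = ψ(q³)⁴`.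
Using it at `q` and at `q³` and eliminating `ψ` yields, with `y = w(3τ)`, `w³ = y (1 - 3w + 3w²)(1 -
3y + 3y²)`, which is the stated equation.

In this factored form the polynomial is monic in `X` and Eisenstein at the prime `Y`. -/

/-! ### Euler products and rotation by cube roots of unity -/

section EulerProduct

open Filter Topology Finset

/-- The Euler product `∏ (1 - q ^ n)` over `n ≥ 1`. -/
noncomputable def eulerProd (q : ℂ) : ℂ := ∏' n : ℕ, (1 - q ^ (n + 1))

lemma one_sub_pow_ne_zero {q : ℂ} (hq : ‖q‖ < 1) {n : ℕ} (hn : n ≠ 0) : 1 - q ^ n ≠ 0 := by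
  intro h
  have h1 : ‖q ^ n‖ = 1 := by rw [← sub_eq_zero.mp h, norm_one]
  rw [norm_pow] at h1
  exact (pow_lt_one₀ (norm_nonneg q) hq hn).ne h1

lemma norm_pow_lt_one {q : ℂ} (hq : ‖q‖ < 1) {n : ℕ} (hn : n ≠ 0) : ‖q ^ n‖ < 1 := by
  rw [norm_pow]
  exact pow_lt_one₀ (norm_nonneg q) hq hn

lemma summable_norm_pow_linear {q : ℂ} (hq : ‖q‖ < 1) {a : ℕ} (ha : a ≠ 0) (b : ℕ) :
    Summable fun n : ℕ ↦ ‖-q ^ (a * n + b)‖ := by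
  have h := (summable_geometric_of_lt_one (norm_nonneg _) (norm_pow_lt_one hq ha)).mul_right
    (‖q‖ ^ b)
  refine h.congr fun n ↦ ?_
  rw [norm_neg, norm_pow, norm_pow, pow_add, pow_mul]

lemma multipliable_one_sub_pow_linear {q : ℂ} (hq : ‖q‖ < 1) {a : ℕ} (ha : a ≠ 0) (b : ℕ) :
    Multipliable fun n : ℕ ↦ 1 - q ^ (a * n + b) := by
  simpa only [sub_eq_add_neg] using
    multipliable_one_add_of_summable (summable_norm_pow_linear hq ha b)

lemma tprod_one_sub_pow_linear_ne_zero {q : ℂ} (hq : ‖q‖ < 1) {a b : ℕ} (ha : a ≠ 0)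
    (hb : b ≠ 0) : ∏' n : ℕ, (1 - q ^ (a * n + b)) ≠ 0 := by
  have h := tprod_one_add_ne_zero_of_summable (f := fun n : ℕ ↦ -q ^ (a * n + b))
    (fun n ↦ by
      rw [← sub_eq_add_neg]
      exact one_sub_pow_ne_zero hq (by omega)) (summable_norm_pow_linear hq ha b)
  simpa only [sub_eq_add_neg] using h

lemma eulerProd_ne_zero {q : ℂ} (hq : ‖q‖ < 1) : eulerProd q ≠ 0 := by
  simpa [eulerProd] using tprod_one_sub_pow_linear_ne_zero hq one_ne_zero one_ne_zero

lemma tendsto_eulerProd {q : ℂ} (hq : ‖q‖ < 1) :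
    Tendsto (fun N : ℕ ↦ ∏ n ∈ range N, (1 - q ^ (n + 1))) atTop (𝓝 (eulerProd q)) :=
  (ModularForm.multipliable_one_sub_pow hq).hasProd.tendsto_prod_nat

lemma tendsto_eulerProd_mul {q : ℂ} (hq : ‖q‖ < 1) {a : ℕ} (ha : a ≠ 0) :
    Tendsto (fun N : ℕ ↦ ∏ n ∈ range (a * N), (1 - q ^ (n + 1))) atTop (𝓝 (eulerProd q)) :=
  (tendsto_eulerProd hq).comp (tendsto_id.const_mul_atTop' (Nat.pos_of_ne_zero ha))

/-- The product of the Euler product over the three cube roots of unity. -/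
lemma eulerProd_mul_rotations {q ω : ℂ} (hq : ‖q‖ < 1) (hω : ω ^ 2 + ω + 1 = 0) :
    eulerProd q * eulerProd (ω * q) * eulerProd (ω ^ 2 * q) * eulerProd (q ^ 9)
      = eulerProd (q ^ 3) ^ 4 := by
  have h3 : ω ^ 3 = 1 := by linear_combination (ω - 1) * hω
  have hω1 : ‖ω‖ = 1 := norm_eq_one_of_pow_eq_one h3 three_ne_zero
  have hq1 : ‖ω * q‖ < 1 := by rwa [norm_mul, hω1, one_mul]
  have hq2 : ‖ω ^ 2 * q‖ < 1 := by rwa [norm_mul, norm_pow, hω1, one_pow, one_mul]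
  -- With these cut-offs the finite products already agree: for `3 ∤ n` the three rotated factors
  -- multiply to `1 - q ^ (3n)`, and for `n = 3m` they are equal, giving `(1 - q ^ (3m))³`.
  have hl := (((tendsto_eulerProd_mul hq three_ne_zero).mul
    (tendsto_eulerProd_mul hq1 three_ne_zero)).mul
    (tendsto_eulerProd_mul hq2 three_ne_zero)).mul
    (tendsto_eulerProd (norm_pow_lt_one hq (n := 9) (by norm_num)))
  have hr := (tendsto_eulerProd_mul (norm_pow_lt_one hq three_ne_zero) three_ne_zero).mul
    ((tendsto_eulerProd (norm_pow_lt_one hq three_ne_zero)).pow 3)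
  rw [pow_succ' _ 3]
  refine tendsto_nhds_unique (hl.congr fun N ↦ ?_) hr
  induction N with
  | zero => simp
  | succ N ih =>
    have key : ∀ x : ℂ, (1 - x) * (1 - ω * x) * (1 - ω ^ 2 * x) = 1 - x ^ 3 := fun x ↦ by
      linear_combination (-x + ω * x ^ 2) * hω - x ^ 3 * h3
    have k1 := key (q ^ (3 * N + 1))
    have k2 := key (q ^ (3 * N + 2))
    have e1 : ω ^ (3 * N) = 1 := by rw [pow_mul, h3, one_pow]
    have k2' : (1 - q ^ (3 * N + 2)) * (1 - ω ^ 2 * q ^ (3 * N + 2)) *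
      (1 - (ω ^ 2) ^ 2 * q ^ (3 * N + 2)) = 1 - (q ^ (3 * N + 2)) ^ 3 := by
      rw [← k2]
      linear_combination -(1 - q ^ (3 * N + 2)) * (1 - ω ^ 2 * q ^ (3 * N + 2)) *
        q ^ (3 * N + 2) * ω * h3
    have f1 : (ω * q) ^ (3 * N + 1) = ω * q ^ (3 * N + 1) := by
      rw [mul_pow, pow_succ ω, e1, one_mul]
    have f2 : (ω * q) ^ (3 * N + 2) = ω ^ 2 * q ^ (3 * N + 2) := by
      rw [mul_pow, pow_add ω, e1, one_mul]
    have f3 : (ω * q) ^ (3 * N + 3) = q ^ (3 * N + 3) := by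
      rw [mul_pow, pow_add ω, e1, h3, one_mul, one_mul]
    have g1 : (ω ^ 2 * q) ^ (3 * N + 1) = ω ^ 2 * q ^ (3 * N + 1) := by
      rw [mul_pow, ← pow_mul, mul_comm 2, pow_mul, pow_succ ω, e1, one_mul]
    have g2 : (ω ^ 2 * q) ^ (3 * N + 2) = (ω ^ 2) ^ 2 * q ^ (3 * N + 2) := by
      rw [mul_pow, pow_add (ω ^ 2), ← pow_mul, mul_comm 2, pow_mul, e1, one_pow, one_mul]
    have g3 : (ω ^ 2 * q) ^ (3 * N + 3) = q ^ (3 * N + 3) := by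
      rw [mul_pow, ← pow_mul, mul_comm 2, pow_mul, pow_add ω, e1, h3]; simp
    have p1 : (q ^ 3) ^ (3 * N + 1) = (q ^ (3 * N + 1)) ^ 3 := by ring
    have p2 : (q ^ 3) ^ (3 * N + 2) = (q ^ (3 * N + 2)) ^ 3 := by ring
    have p3 : (q ^ 3) ^ (3 * N + 3) = (q ^ 9) ^ (N + 1) := by ring
    have p4 : (q ^ 3) ^ (N + 1) = q ^ (3 * N + 3) := by ring
    simp only [show 3 * (N + 1) = 3 * N + 1 + 1 + 1 by ring, prod_range_succ, add_assoc,
      Nat.reduceAdd, f1, f2, f3, g1, g2, g3, p1, p2, p3, p4, ← k1, ← k2'] at ih ⊢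
    linear_combination (1 - q ^ (3 * N + 1)) * (1 - ω * q ^ (3 * N + 1)) *
      (1 - ω ^ 2 * q ^ (3 * N + 1)) * ((1 - q ^ (3 * N + 2)) * (1 - ω ^ 2 * q ^ (3 * N + 2)) *
      (1 - (ω ^ 2) ^ 2 * q ^ (3 * N + 2))) * (1 - q ^ (3 * N + 3)) ^ 3 *
      (1 - (q ^ 9) ^ (N + 1)) * ih

lemma tprod_odd_mul_eulerProd {q : ℂ} (hq : ‖q‖ < 1) :
    (∏' n : ℕ, (1 - q ^ (2 * n + 1))) * eulerProd (q ^ 2) = eulerProd q := by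
  have hl := (multipliable_one_sub_pow_linear hq two_ne_zero 1).hasProd.tendsto_prod_nat.mul
    (tendsto_eulerProd (norm_pow_lt_one hq two_ne_zero))
  refine tendsto_nhds_unique (hl.congr fun N ↦ ?_) (tendsto_eulerProd_mul hq two_ne_zero)
  induction N with
  | zero => simp
  | succ N ih =>
    rw [show 2 * (N + 1) = 2 * N + 1 + 1 by ring]
    simp only [prod_range_succ] at ih ⊢
    rw [← ih]
    ring

end EulerProduct

/-! ### Gauss's identity and the cubic relation for `ψ` -/

section Psi

open Filter Topology Finset

/-- Ramanujan's theta function `ψ(q) = ∑ q ^ (n (n + 1) / 2)`. -/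
noncomputable def thetaPsi (q : ℂ) : ℂ := ∑' n : ℕ, q ^ (n * (n + 1) / 2)

/-- The partial products of `∏ (1 - q ^ (2 n)) / (1 - q ^ (2 n - 1))`. -/
noncomputable def psiProd (q : ℂ) (n : ℕ) : ℂ :=
  ∏ k ∈ range n, (1 - q ^ (2 * k + 2)) / (1 - q ^ (2 * k + 1))

lemma psiProd_succ (q : ℂ) (n : ℕ) : psiProd q (n + 1) =
    psiProd q n * ((1 - q ^ (2 * n + 2)) / (1 - q ^ (2 * n + 1))) := prod_range_succ _ _

lemma psiProd_ne_zero {q : ℂ} (hq : ‖q‖ < 1) (n : ℕ) : psiProd q n ≠ 0 :=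
  prod_ne_zero_iff.mpr fun _ _ ↦
    div_ne_zero (one_sub_pow_ne_zero hq (by omega)) (one_sub_pow_ne_zero hq (by omega))

lemma tendsto_psiProd {q : ℂ} (hq : ‖q‖ < 1) :
    Tendsto (psiProd q) atTop (𝓝 (eulerProd (q ^ 2) / ∏' n : ℕ, (1 - q ^ (2 * n + 1)))) := by
  have h := (tendsto_eulerProd (norm_pow_lt_one hq two_ne_zero)).div
    (multipliable_one_sub_pow_linear hq two_ne_zero 1).hasProd.tendsto_prod_nat
    (tprod_one_sub_pow_linear_ne_zero hq two_ne_zero one_ne_zero)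
  refine h.congr fun N ↦ ?_
  simp only [psiProd, Pi.div_apply, ← prod_div_distrib]
  refine prod_congr rfl fun n _ ↦ ?_
  rw [← pow_mul]
  rfl

lemma summable_norm_triangle {q : ℂ} (hq : ‖q‖ < 1) :
    Summable fun n : ℕ ↦ ‖q ^ (n * (n + 1) / 2)‖ := by
  refine Summable.of_nonneg_of_le (fun _ ↦ norm_nonneg _) (fun n ↦ ?_)
    (summable_geometric_of_lt_one (norm_nonneg _) hq)
  rw [norm_pow]
  refine pow_le_pow_of_le_one (norm_nonneg _) hq.le ?_
  rw [Nat.le_div_iff_mul_le two_pos]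
  rcases n with _ | n
  · simp
  · gcongr; omega

/-- The telescoping sum behind Shanks' identity. -/
lemma sum_psiProd_telescope {q : ℂ} (hq : ‖q‖ < 1) (n m : ℕ) :
    ∑ s ∈ range m, (psiProd q (n + 1) / psiProd q s * q ^ (s * (2 * n + 3))
        - psiProd q n / psiProd q s * q ^ (s * (2 * n + 1)))
      = psiProd q n / psiProd q m * q ^ (m * (2 * n + 1)) * (1 - q ^ (2 * m))
        / (1 - q ^ (2 * n + 1)) := by
  have h1 : 1 - q ^ (2 * n + 1) ≠ 0 := one_sub_pow_ne_zero hq (by omega)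
  induction m with
  | zero => simp
  | succ m ih =>
    rw [sum_range_succ, ih, psiProd_succ, psiProd_succ]
    have h2 : 1 - q ^ (2 * m + 1) ≠ 0 := one_sub_pow_ne_zero hq (by omega)
    have h3 : 1 - q ^ (2 * m + 2) ≠ 0 := one_sub_pow_ne_zero hq (by omega)
    have h4 := psiProd_ne_zero hq m
    have e : 2 * (m + 1) = 2 * m + 2 := by ring
    rw [e]
    field_simp
    ring

/-- Shanks' finite form of Gauss's identity. -/
lemma sum_psiProd_eq {q : ℂ} (hq : ‖q‖ < 1) (n : ℕ) :
    ∑ s ∈ range (n + 1), psiProd q n / psiProd q s * q ^ (s * (2 * n + 1))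
      = ∑ k ∈ range (2 * n + 1), q ^ (k * (k + 1) / 2) := by
  induction n with
  | zero => simp [psiProd]
  | succ n ih =>
    -- Passing from `n` to `n + 1` adds two terms: the telescoped difference is `q` to the
    -- triangular number of `2n + 1`, and the new summand `s = n + 1` is `q` to that of `2n + 2`.
    have ht := sum_psiProd_telescope hq n (n + 1)
    rw [sum_sub_distrib, ih] at ht
    rw [sum_range_succ, show 2 * (n + 1) + 1 = 2 * n + 1 + 1 + 1 by ring,
      sum_range_succ _ (2 * n + 2), sum_range_succ _ (2 * n + 1), div_self (psiProd_ne_zero hq _)]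
    have t1 : (2 * n + 1) * (2 * n + 1 + 1) / 2 = (n + 1) * (2 * n + 1) := by
      rw [show (2 * n + 1) * (2 * n + 1 + 1) = 2 * ((n + 1) * (2 * n + 1)) by ring]
      exact Nat.mul_div_cancel_left _ two_pos
    have t2 : (2 * n + 2) * (2 * n + 2 + 1) / 2 = (n + 1) * (2 * n + 3) := by
      rw [show (2 * n + 2) * (2 * n + 2 + 1) = 2 * ((n + 1) * (2 * n + 3)) by ring]
      exact Nat.mul_div_cancel_left _ two_pos
    have h1 : 1 - q ^ (2 * n + 1) ≠ 0 := one_sub_pow_ne_zero hq (by omega)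
    have h3 : 1 - q ^ (2 * n + 2) ≠ 0 := one_sub_pow_ne_zero hq (by omega)
    have h4 := psiProd_ne_zero hq n
    have hlast : psiProd q n / psiProd q (n + 1) * q ^ ((n + 1) * (2 * n + 1)) *
        (1 - q ^ (2 * (n + 1))) / (1 - q ^ (2 * n + 1)) = q ^ ((n + 1) * (2 * n + 1)) := by
      rw [psiProd_succ, show 2 * (n + 1) = 2 * n + 2 by ring]
      field_simp
    rw [hlast] at ht
    rw [t1, t2]
    linear_combination ht

/-- These are the terms `s ≥ 1` of Shanks' sum, so only the `s = 0` term `psiProd q n` survives in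
the limit. The partial products and their inverses are bounded because the limit is nonzero, and `(s
+ 1)(2n + 1) ≥ s + n` leaves a geometric series times `‖q‖ ^ n`. -/
lemma tendsto_sum_psiProd {q : ℂ} (hq : ‖q‖ < 1) :
    Tendsto (fun n ↦ ∑ s ∈ range n, psiProd q n / psiProd q (s + 1) * q ^ ((s + 1) * (2 * n + 1)))
      atTop (𝓝 0) := by
  set L := eulerProd (q ^ 2) / ∏' n : ℕ, (1 - q ^ (2 * n + 1)) with hL
  have hL0 : L ≠ 0 := div_ne_zero (eulerProd_ne_zero (norm_pow_lt_one hq two_ne_zero))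
    (tprod_one_sub_pow_linear_ne_zero hq two_ne_zero one_ne_zero)
  obtain ⟨C, hC⟩ := (Metric.isBounded_range_of_tendsto _ (tendsto_psiProd hq)).exists_norm_le
  obtain ⟨D, hD⟩ := (Metric.isBounded_range_of_tendsto _
    ((tendsto_psiProd hq).inv₀ hL0)).exists_norm_le
  have hC' (n : ℕ) : ‖psiProd q n‖ ≤ C := hC _ ⟨n, rfl⟩
  have hD' (n : ℕ) : ‖(psiProd q n)⁻¹‖ ≤ D := hD _ ⟨n, rfl⟩
  have hC0 : 0 ≤ C := (norm_nonneg _).trans (hC' 0)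
  have hD0 : 0 ≤ D := (norm_nonneg _).trans (hD' 0)
  have hr := norm_nonneg q
  refine squeeze_zero_norm (a := fun n ↦ C * D * ((1 - ‖q‖)⁻¹ * ‖q‖ ^ n)) (fun n ↦ ?_) ?_
  · have hs : ∑ s ∈ range n, ‖q‖ ^ s ≤ (1 - ‖q‖)⁻¹ := by
      rw [← tsum_geometric_of_lt_one hr hq]
      exact (summable_geometric_of_lt_one hr hq).sum_le_tsum _ fun _ _ ↦ by positivity
    calc _ ≤ ∑ s ∈ range n, C * D * (‖q‖ ^ s * ‖q‖ ^ n) := by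
          refine norm_sum_le_of_le _ fun s _ ↦ ?_
          rw [div_eq_mul_inv, norm_mul, norm_mul, norm_pow, ← pow_add]
          refine mul_le_mul (mul_le_mul (hC' _) (hD' _) (norm_nonneg _) hC0) ?_ (by positivity)
            (by positivity)
          refine pow_le_pow_of_le_one hr hq.le ?_
          nlinarith [Nat.zero_le (s * n)]
      _ = C * D * ((∑ s ∈ range n, ‖q‖ ^ s) * ‖q‖ ^ n) := by rw [← mul_sum, ← sum_mul]
      _ ≤ _ := by gcongr
  · simpa using ((tendsto_pow_atTop_nhds_zero_of_lt_one hr hq).const_mul (1 - ‖q‖)⁻¹).const_mul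
      (C * D)

/-- **Gauss's identity** `ψ(q) = ∏ (1 - q ^ (2 n)) / (1 - q ^ (2 n - 1))`. -/
lemma thetaPsi_mul_eulerProd {q : ℂ} (hq : ‖q‖ < 1) :
    thetaPsi q * eulerProd q = eulerProd (q ^ 2) ^ 2 := by
  have h1 : Tendsto (fun n : ℕ ↦ ∑ k ∈ range (2 * n + 1), q ^ (k * (k + 1) / 2)) atTop
      (𝓝 (thetaPsi q)) :=
    (summable_norm_triangle hq).of_norm.hasSum.tendsto_sum_nat.comp
      (tendsto_atTop_mono (fun n ↦ by simp only [id]; omega) tendsto_id)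
  have h2 := (tendsto_sum_psiProd hq).add (tendsto_psiProd hq)
  have h3 := tendsto_nhds_unique h1 (h2.congr fun n ↦ ?_)
  · have h0 := tprod_one_sub_pow_linear_ne_zero hq two_ne_zero one_ne_zero
    rw [h3, ← tprod_odd_mul_eulerProd hq, zero_add]
    field_simp
  · rw [← sum_psiProd_eq hq n, sum_range_succ']
    simp [psiProd]

lemma thetaPsi_ne_zero {q : ℂ} (hq : ‖q‖ < 1) : thetaPsi q ≠ 0 := fun h ↦ by
  have := thetaPsi_mul_eulerProd hq
  rw [h, zero_mul] at this
  exact pow_ne_zero 2 (eulerProd_ne_zero (norm_pow_lt_one hq two_ne_zero)) this.symm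

lemma triangle_three_mul_add_one (n : ℕ) :
    (3 * n + 1) * (3 * n + 1 + 1) / 2 = 9 * (n * (n + 1) / 2) + 1 := by
  obtain ⟨m, hm⟩ := Nat.even_mul_succ_self n
  have h : (3 * n + 1) * (3 * n + 1 + 1) = 9 * (n * (n + 1)) + 2 := by ring
  omega

lemma three_dvd_triangle {n : ℕ} (hn : n % 3 ≠ 1) : 3 ∣ n * (n + 1) / 2 := by
  have h : 3 ∣ n * (n + 1) := by
    rcases (by omega : n % 3 = 0 ∨ n % 3 = 2) with h | h
    · exact (Nat.dvd_of_mod_eq_zero h).mul_right _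
    · exact Dvd.dvd.mul_left (by omega) _
  obtain ⟨m, hm⟩ := Nat.even_mul_succ_self n
  omega

/-- The indices `3k + 1` have triangular number nine times that of `k`, plus one, so they sum to the
second term. -/
lemma thetaPsi_eq_add {q : ℂ} (hq : ‖q‖ < 1) :
    thetaPsi q = (∑' n : ↥({n : ℕ | n % 3 = 1}ᶜ : Set ℕ), q ^ ((n : ℕ) * (n + 1) / 2))
      + q * thetaPsi (q ^ 9) := by
  rw [add_comm, thetaPsi,
    ← (summable_norm_triangle hq).of_norm.tsum_subtype_add_tsum_subtype_compl {n : ℕ | n % 3 = 1}]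
  congr 1
  have hinj : Function.Injective fun n : ℕ ↦ 3 * n + 1 := fun a b h ↦ by
    simp only at h
    omega
  have hset : {n : ℕ | n % 3 = 1} = Set.range fun n : ℕ ↦ 3 * n + 1 := by
    ext n
    simp only [Set.mem_ofPred_eq, Set.mem_range]
    exact ⟨fun h ↦ ⟨n / 3, by omega⟩, by rintro ⟨k, rfl⟩; omega⟩
  rw [hset, tsum_range (fun n : ℕ ↦ q ^ (n * (n + 1) / 2)) hinj, thetaPsi, ← tsum_mul_left]
  refine tsum_congr fun n ↦ ?_
  rw [triangle_three_mul_add_one, pow_succ', pow_mul]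

/-- The part of `ψ(q)` with exponents divisible by three is invariant under rotation by a cube
root of unity. -/
lemma thetaPsi_rotation {q ω : ℂ} (hq : ‖q‖ < 1) (hω : ω ^ 3 = 1) :
    thetaPsi (ω * q) = thetaPsi q - q * thetaPsi (q ^ 9) + ω * (q * thetaPsi (q ^ 9)) := by
  have hω1 : ‖ω‖ = 1 := norm_eq_one_of_pow_eq_one hω three_ne_zero
  have hq1 : ‖ω * q‖ < 1 := by rwa [norm_mul, hω1, one_mul]
  have h9 : (ω * q) ^ 9 = q ^ 9 := by
    rw [mul_pow, show ω ^ 9 = (ω ^ 3) ^ 3 by ring, hω, one_pow, one_mul]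
  rw [thetaPsi_eq_add hq1, thetaPsi_eq_add hq, h9]
  have : ∀ n : ({n : ℕ | n % 3 = 1}ᶜ : Set ℕ),
      (ω * q) ^ ((n : ℕ) * (n + 1) / 2) = q ^ ((n : ℕ) * (n + 1) / 2) := fun n ↦ by
    obtain ⟨k, hk⟩ := three_dvd_triangle n.2
    rw [hk, mul_pow, pow_mul, hω, one_pow, one_mul]
  simp only [this]
  ring

/-- The relation between `ψ(q)`, `ψ(q³)` and `ψ(q⁹)`. -/
lemma thetaPsi_cubic {q : ℂ} (hq : ‖q‖ < 1) :
    thetaPsi (q ^ 9) * ((thetaPsi q - q * thetaPsi (q ^ 9)) ^ 3 + (q * thetaPsi (q ^ 9)) ^ 3)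
      = thetaPsi (q ^ 3) ^ 4 := by
  obtain ⟨ω, hω⟩ : ∃ ω : ℂ, ω ^ 2 + ω + 1 = 0 := by
    obtain ⟨ω, hω⟩ := IsAlgClosed.exists_pow_nat_eq (-3 : ℂ) two_pos
    exact ⟨(ω - 1) / 2, by linear_combination hω / 4⟩
  have h3 : ω ^ 3 = 1 := by linear_combination (ω - 1) * hω
  have h6 : (ω ^ 2) ^ 3 = 1 := by rw [← pow_mul, mul_comm, pow_mul, h3, one_pow]
  have hω1 : ‖ω‖ = 1 := norm_eq_one_of_pow_eq_one h3 three_ne_zero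
  have hq1 : ‖ω * q‖ < 1 := by rwa [norm_mul, hω1, one_mul]
  have hq2 : ‖ω ^ 2 * q‖ < 1 := by rwa [norm_mul, norm_pow, hω1, one_pow, one_mul]
  have hn : ∀ n ≠ 0, ‖q ^ n‖ < 1 := fun n hn ↦ norm_pow_lt_one hq hn
  -- The factorization `(x + y)(x + ωy)(x + ω²y) = x³ + y³`.
  have hprod : thetaPsi q * thetaPsi (ω * q) * thetaPsi (ω ^ 2 * q)
      = (thetaPsi q - q * thetaPsi (q ^ 9)) ^ 3 + (q * thetaPsi (q ^ 9)) ^ 3 := by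
    rw [thetaPsi_rotation hq h3, thetaPsi_rotation hq h6]
    generalize q * thetaPsi (q ^ 9) = y
    generalize hx : thetaPsi q - y = x
    rw [show thetaPsi q = x + y by rw [← hx]; ring]
    linear_combination (x ^ 2 * y + x * y ^ 2 * ω) * hω + y ^ 3 * h3
  rw [← hprod]
  have g0 := thetaPsi_mul_eulerProd hq
  have g1 := thetaPsi_mul_eulerProd hq1
  have g2 := thetaPsi_mul_eulerProd hq2
  have g3 := thetaPsi_mul_eulerProd (hn 3 (by norm_num))
  have g9 := thetaPsi_mul_eulerProd (hn 9 (by norm_num))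
  have r1 := eulerProd_mul_rotations hq hω
  -- Gauss's identity squares the argument, so the right-hand sides involve rotations of `q²` by
  -- `ω²`.
  have hω' : (ω ^ 2) ^ 2 + ω ^ 2 + 1 = 0 := by linear_combination (ω ^ 2 - ω + 1) * hω
  have r2 := eulerProd_mul_rotations (hn 2 (by norm_num)) hω'
  simp only [mul_pow, ← pow_mul, Nat.reduceMul] at g0 g1 g2 g3 g9 r1 r2
  refine mul_right_cancel₀ (pow_ne_zero 4 (eulerProd_ne_zero (hn 3 three_ne_zero))) ?_
  calc _ = thetaPsi (q ^ 9) * (thetaPsi q * thetaPsi (ω * q) * thetaPsi (ω ^ 2 * q)) *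
        (eulerProd q * eulerProd (ω * q) * eulerProd (ω ^ 2 * q) * eulerProd (q ^ 9)) := by rw [r1]
    _ = (thetaPsi q * eulerProd q) * (thetaPsi (ω * q) * eulerProd (ω * q)) *
        (thetaPsi (ω ^ 2 * q) * eulerProd (ω ^ 2 * q)) *
        (thetaPsi (q ^ 9) * eulerProd (q ^ 9)) := by ring
    _ = (eulerProd (q ^ 2) * eulerProd (ω ^ 2 * q ^ 2) * eulerProd (ω ^ 4 * q ^ 2) *
        eulerProd (q ^ 18)) ^ 2 := by rw [g0, g1, g2, g9]; ring
    _ = (thetaPsi (q ^ 3) * eulerProd (q ^ 3)) ^ 4 := by rw [r2, g3]; ring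
    _ = _ := by ring

end Psi

/-! ### The modular equation from the cubic relation -/

section LevelThree

open Filter Topology Finset

/-- By inclusion–exclusion the exponents `±1` mod 6 give `E(q) E(q⁶) / (E(q²) E(q³))`; the exponents
`±2` mod 6 give `E(q²) / E(q⁶)`. -/
lemma tprod_sixFactor_mul {τ : ℂ} (hq : ‖nome τ‖ < 1) :
    (∏' n : ℕ, sixFactor n τ) * (eulerProd (nome τ ^ 2) ^ 2 * eulerProd (nome τ ^ 3))
      = eulerProd (nome τ) * eulerProd (nome τ ^ 6) ^ 2 := by
  have h6 : (6 : ℕ) ≠ 0 := by norm_num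
  have hm : Multipliable fun n : ℕ ↦ sixFactor n τ := by
    have hden := (multipliable_one_sub_pow_linear hq h6 4).mul
      (multipliable_one_sub_pow_linear hq h6 2)
    refine ((multipliable_one_sub_pow_linear hq h6 5).mul
      (multipliable_one_sub_pow_linear hq h6 1)).div₀ hden ?_
    rw [Multipliable.tprod_mul (multipliable_one_sub_pow_linear hq h6 4)
      (multipliable_one_sub_pow_linear hq h6 2)]
    exact mul_ne_zero (tprod_one_sub_pow_linear_ne_zero hq h6 (by norm_num))
      (tprod_one_sub_pow_linear_ne_zero hq h6 (by norm_num))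
  -- Each product is cut off at exponent `6N`, which makes the identity exact for every `N`.
  have hl := hm.hasProd.tendsto_prod_nat.mul
    (((tendsto_eulerProd_mul (norm_pow_lt_one hq two_ne_zero) three_ne_zero).pow 2).mul
    (tendsto_eulerProd_mul (norm_pow_lt_one hq three_ne_zero) two_ne_zero))
  have hr := (tendsto_eulerProd_mul hq h6).mul ((tendsto_eulerProd (norm_pow_lt_one hq h6)).pow 2)
  refine tendsto_nhds_unique (hl.congr fun N ↦ ?_) hr
  induction N with
  | zero => simp
  | succ N ih =>
    have h2 : 1 - nome τ ^ (6 * N + 2) ≠ 0 := one_sub_pow_ne_zero hq (by omega)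
    have h4 : 1 - nome τ ^ (6 * N + 4) ≠ 0 := one_sub_pow_ne_zero hq (by omega)
    have hdiv : sixFactor N τ * ((1 - nome τ ^ (6 * N + 4)) * (1 - nome τ ^ (6 * N + 2))) =
        (1 - nome τ ^ (6 * N + 5)) * (1 - nome τ ^ (6 * N + 1)) :=
      div_mul_cancel₀ _ (mul_ne_zero h4 h2)
    rw [show 3 * (N + 1) = 3 * N + 1 + 1 + 1 by ring, show 2 * (N + 1) = 2 * N + 1 + 1 by ring,
      show 6 * (N + 1) = 6 * N + 1 + 1 + 1 + 1 + 1 + 1 by ring]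
    simp only [prod_range_succ, add_assoc, Nat.reduceAdd] at ih ⊢
    have p1 : (nome τ ^ 2) ^ (3 * N + 1) = nome τ ^ (6 * N + 2) := by ring
    have p2 : (nome τ ^ 2) ^ (3 * N + 2) = nome τ ^ (6 * N + 4) := by ring
    have p3 : (nome τ ^ 2) ^ (3 * N + 3) = nome τ ^ (6 * N + 6) := by ring
    have p4 : (nome τ ^ 3) ^ (2 * N + 1) = nome τ ^ (6 * N + 3) := by ring
    have p5 : (nome τ ^ 3) ^ (2 * N + 2) = nome τ ^ (6 * N + 6) := by ring
    have p6 : (nome τ ^ 6) ^ (N + 1) = nome τ ^ (6 * N + 6) := by ring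
    rw [p1, p2, p3, p4, p5, p6]
    generalize sixFactor N τ = r at hdiv ⊢
    generalize nome τ ^ (6 * N + 1) = x1 at *
    generalize nome τ ^ (6 * N + 2) = x2 at *
    generalize nome τ ^ (6 * N + 3) = x3 at *
    generalize nome τ ^ (6 * N + 4) = x4 at *
    generalize nome τ ^ (6 * N + 5) = x5 at *
    generalize nome τ ^ (6 * N + 6) = x6 at *
    generalize (∏ n ∈ range N, sixFactor n τ) = S at *
    generalize (∏ n ∈ range (3 * N), (1 - (nome τ ^ 2) ^ (n + 1))) = A at *
    generalize (∏ n ∈ range (2 * N), (1 - (nome τ ^ 3) ^ (n + 1))) = B at *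
    linear_combination (1 - x1) * (1 - x2) * (1 - x3) * (1 - x4) * (1 - x5) * (1 - x6) ^ 3 * ih +
      S * A ^ 2 * B * (1 - x2) * (1 - x4) * (1 - x6) ^ 3 * (1 - x3) * hdiv

lemma nome_three_mul (τ : ℂ) : nome (3 * τ) = nome τ ^ 3 := by
  rw [nome, nome, ← Complex.exp_nat_mul]
  congr 1
  push_cast
  ring

lemma norm_nome_lt_one (τ : ℍ) : ‖nome τ‖ < 1 := norm_exp_two_pi_I_lt_one τ

/-- The quotient `w` in terms of `ψ`. -/
lemma wFun_mul_thetaPsi {τ : ℂ} (hq : ‖nome τ‖ < 1) :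
    wFun τ * thetaPsi (nome τ) = nome τ * thetaPsi (nome τ ^ 9) := by
  have hn : ∀ n ≠ 0, ‖nome τ ^ n‖ < 1 := fun n hn ↦ norm_pow_lt_one hq hn
  have hE : ∀ n ≠ 0, eulerProd (nome τ ^ n) ≠ 0 := fun n h ↦ eulerProd_ne_zero (hn n h)
  have s1 := tprod_sixFactor_mul hq
  have s3 := tprod_sixFactor_mul (τ := 3 * τ) (by rw [nome_three_mul]; exact hn 3 three_ne_zero)
  have g1 := thetaPsi_mul_eulerProd hq
  have g9 := thetaPsi_mul_eulerProd (hn 9 (by norm_num))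
  rw [nome_three_mul] at s3
  simp only [← pow_mul, Nat.reduceMul] at s3 g9
  have hexp : exp (2 * Real.pi * Complex.I * τ / 4) *
      exp (2 * Real.pi * Complex.I * (3 * τ) / 4) = nome τ := by
    rw [nome, ← Complex.exp_add]
    congr 1
    ring
  have e1 := eulerProd_ne_zero hq
  have e2 := hE 2 (by norm_num)
  have e3 := hE 3 (by norm_num)
  have e6 := hE 6 (by norm_num)
  have e9 := hE 9 (by norm_num)
  rw [wFun, contFracSix, contFracSix]
  rw [← eq_div_iff (mul_ne_zero (pow_ne_zero 2 e2) e3)] at s1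
  rw [← eq_div_iff (mul_ne_zero (pow_ne_zero 2 e6) e9)] at s3
  rw [← eq_div_iff e1] at g1
  rw [← eq_div_iff e9] at g9
  rw [s1, s3, g1, g9]
  refine .trans ?_ (congrArg (· * (eulerProd (nome τ ^ 18) ^ 2 / eulerProd (nome τ ^ 9))) hexp)
  field_simp

/-- Elimination step, with `a, b, c, d` standing for `ψ` at `q, q³, q⁹, q²⁷`. -/
lemma wFun_level_three_aux {a b c d q w y : ℂ} (ha : a ≠ 0) (hb : b ≠ 0) (hc : c ≠ 0)
    (h1 : c * ((a - q * c) ^ 3 + (q * c) ^ 3) = b ^ 4)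
    (h2 : d * ((b - q ^ 3 * d) ^ 3 + (q ^ 3 * d) ^ 3) = c ^ 4)
    (hw : w * a = q * c) (hy : y * b = q ^ 3 * d) :
    w ^ 3 = y * (1 - 3 * w + 3 * w ^ 2) * (1 - 3 * y + 3 * y ^ 2) := by
  have k1 : c * (a ^ 3 * (1 - 3 * w + 3 * w ^ 2)) = b ^ 4 := by
    rw [← h1, ← hw]; ring
  have k2 : d * (b ^ 3 * (1 - 3 * y + 3 * y ^ 2)) = c ^ 4 := by
    rw [← h2, ← hy]; ring
  refine mul_right_cancel₀ (mul_ne_zero (mul_ne_zero (pow_ne_zero 3 ha) (pow_ne_zero 4 hb)) hc) ?_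
  calc w ^ 3 * (a ^ 3 * b ^ 4 * c) = (w * a) ^ 3 * b ^ 4 * c := by ring
    _ = q ^ 3 * b ^ 4 * c ^ 4 := by rw [hw]; ring
    _ = (q ^ 3 * d) * b ^ 3 * (c * (a ^ 3 * (1 - 3 * w + 3 * w ^ 2))) *
        (1 - 3 * y + 3 * y ^ 2) := by rw [k1, ← k2]; ring
    _ = _ := by rw [← hy]; ring

lemma wFun_pow_three (τ : ℍ) : wFun τ ^ 3 = wFun (3 * τ) * (1 - 3 * wFun τ + 3 * wFun τ ^ 2) *
    (1 - 3 * wFun (3 * τ) + 3 * wFun (3 * τ) ^ 2) := by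
  have hq := norm_nome_lt_one τ
  have hq3 := norm_pow_lt_one hq three_ne_zero
  have h2 := thetaPsi_cubic hq3
  have hy := wFun_mul_thetaPsi (τ := 3 * τ) (by rwa [nome_three_mul])
  rw [nome_three_mul] at hy
  simp only [← pow_mul, Nat.reduceMul] at h2 hy
  exact wFun_level_three_aux (thetaPsi_ne_zero hq) (thetaPsi_ne_zero hq3)
    (thetaPsi_ne_zero (norm_pow_lt_one hq (by norm_num))) (thetaPsi_cubic hq) h2
    (wFun_mul_thetaPsi hq) hy

end LevelThree

/-! ### Irreducibility and degrees of the polynomial -/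

section Irreducibility

open MvPolynomial

lemma map_levelThreePoly : MvPolynomial.map (Int.castRingHom ℂ) levelThreePoly =
    X 0 ^ 3 - X 1 * (1 - 3 * X 0 + 3 * X 0 ^ 2) * (1 - 3 * X 1 + 3 * X 1 ^ 2) := by
  simp only [levelThreePoly, map_sub, map_add, map_mul, map_pow, map_X, map_ofNat]
  ring

/-- On the right `X 0` is the old variable `Y`. The ring is general because irreducibility needs `ℂ`
and the degree needs `ℤ`. -/
lemma finSuccEquiv_levelThreePoly {R : Type*} [CommRing R] :
    finSuccEquiv R 1 (X 0 ^ 3 - X 1 * (1 - 3 * X 0 + 3 * X 0 ^ 2) * (1 - 3 * X 1 + 3 * X 1 ^ 2)) =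
    Polynomial.X ^ 3 + Polynomial.C (X 0 * (1 - 3 * X 0 + 3 * X 0 ^ 2)) *
      (-3 * Polynomial.X ^ 2 + 3 * Polynomial.X - 1) := by
  have h : finSuccEquiv R 1 (X 1) = Polynomial.C (X 0) := finSuccEquiv_X_succ (j := 0)
  simp only [map_sub, map_add, map_mul, map_pow, map_one, map_ofNat, h, finSuccEquiv_X_zero]
  ring

/-- Eisenstein at `(Y)`: all lower coefficients are multiples of `u = Y (1 - 3Y + 3Y²)`, and the
constant term `-u` is not divisible by `Y²`. -/
lemma irreducible_levelThreePoly :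
    Irreducible (MvPolynomial.map (Int.castRingHom ℂ) levelThreePoly) := by
  rw [← MulEquiv.irreducible_iff (finSuccEquiv ℂ 1), map_levelThreePoly,
    finSuccEquiv_levelThreePoly]
  set u : MvPolynomial (Fin 1) ℂ := X 0 * (1 - 3 * X 0 + 3 * X 0 ^ 2) with hu
  have hP : (Ideal.span {(X 0 : MvPolynomial (Fin 1) ℂ)}).IsPrime :=
    (Ideal.span_singleton_prime (X_ne_zero 0)).mpr X_prime
  set f : Polynomial (MvPolynomial (Fin 1) ℂ) :=
    Polynomial.X ^ 3 + Polynomial.C u * (-3 * Polynomial.X ^ 2 + 3 * Polynomial.X - 1) with hf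
  have hdeg : (Polynomial.C u * (-3 * Polynomial.X ^ 2 + 3 * Polynomial.X - 1)).degree
      < 3 := by
    refine lt_of_le_of_lt (b := 2) ?_ (by norm_num)
    compute_degree
  have hmonic : f.Monic := Polynomial.monic_X_pow_add hdeg
  have hnat : f.natDegree = 3 :=
    Polynomial.natDegree_eq_of_degree_eq_some (by
      rw [hf, Polynomial.degree_add_eq_left_of_degree_lt (by simpa using hdeg)]
      simp)
  refine Polynomial.IsEisensteinAt.irreducible (𝓟 := Ideal.span {X 0}) ⟨?_, fun {n} hn ↦ ?_, ?_⟩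
    hP hmonic.isPrimitive (by omega)
  · rw [hmonic.leadingCoeff]
    exact fun h ↦ hP.ne_top ((Ideal.eq_top_iff_one _).mpr h)
  · rw [hnat] at hn
    rw [hf, Polynomial.coeff_add, Polynomial.coeff_X_pow, if_neg hn.ne, zero_add,
      Polynomial.coeff_C_mul, hu, mul_assoc]
    exact Ideal.mul_mem_right _ _ (Ideal.mem_span_singleton_self _)
  · have h0 : f.coeff 0 = -u := by simp [hf, Polynomial.coeff_zero_eq_eval_zero]
    rw [h0, Ideal.span_singleton_pow, Ideal.mem_span_singleton, dvd_neg, hu, sq]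
    intro h
    have h1 := (mul_dvd_mul_iff_left (X_ne_zero 0)).mp h
    obtain ⟨g, hg⟩ := h1
    -- At `Y = 0` the cofactor `1 - 3Y + 3Y²` equals `1`, so `Y` cannot divide it.
    simpa using congrArg (eval fun _ ↦ 0) hg

lemma levelThreePoly_eq : levelThreePoly =
    X 0 ^ 3 - X 1 * (1 - 3 * X 0 + 3 * X 0 ^ 2) * (1 - 3 * X 1 + 3 * X 1 ^ 2) := by
  simp only [levelThreePoly]
  ring

lemma degreeOf_zero_levelThreePoly : degreeOf 0 levelThreePoly = 3 := by
  rw [← natDegree_finSuccEquiv, levelThreePoly_eq, finSuccEquiv_levelThreePoly]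
  compute_degree!

/-- `finSuccEquiv` singles out variable `0`, so the variables are swapped to read off the degree in
`Y`; here `X 0` on the right is the old `X`. -/
lemma finSuccEquiv_rename_swap_levelThreePoly :
    finSuccEquiv ℤ 1 (rename (Equiv.swap 0 1) levelThreePoly) =
    Polynomial.C (-(3 * (1 - 3 * X 0 + 3 * X 0 ^ 2)) : MvPolynomial (Fin 1) ℤ) * Polynomial.X ^ 3 +
      Polynomial.C (1 - 3 * X 0 + 3 * X 0 ^ 2) * (3 * Polynomial.X ^ 2 - Polynomial.X) +
      Polynomial.C (X 0 ^ 3) := by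
  have h : finSuccEquiv ℤ 1 (X 1) = Polynomial.C (X 0) := finSuccEquiv_X_succ (j := 0)
  simp only [levelThreePoly_eq, map_sub, map_add, map_mul, map_pow, map_one, map_ofNat, rename_X,
    Equiv.swap_apply_left, Equiv.swap_apply_right, h, map_neg, finSuccEquiv_X_zero]
  ring

lemma degreeOf_one_levelThreePoly : degreeOf 1 levelThreePoly = 3 := by
  have hr := degreeOf_rename_of_injective (p := levelThreePoly)
    (Equiv.injective (Equiv.swap (0 : Fin 2) 1)) 1
  rw [Equiv.swap_apply_right] at hr
  rw [← hr, ← natDegree_finSuccEquiv, finSuccEquiv_rename_swap_levelThreePoly]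
  have h0 : (1 - 3 * X 0 + 3 * X 0 ^ 2 : MvPolynomial (Fin 1) ℤ) ≠ 0 := fun h ↦ by
    simpa using congrArg (eval fun _ ↦ 0) h
  compute_degree!

end Irreducibility

theorem theorem4 :
    (∀ τ : ℍ,
      wFun τ ^ 3 - wFun (3 * τ) + 3 * wFun τ * wFun (3 * τ) - 3 * wFun τ ^ 2 * wFun (3 * τ)
        + 3 * wFun (3 * τ) ^ 2 - 9 * wFun τ * wFun (3 * τ) ^ 2
        + 9 * wFun τ ^ 2 * wFun (3 * τ) ^ 2 - 3 * wFun (3 * τ) ^ 3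
        + 9 * wFun τ * wFun (3 * τ) ^ 3 - 9 * wFun τ ^ 2 * wFun (3 * τ) ^ 3 = 0) ∧
    IsModularEquation wFun 3 (MvPolynomial.map (Int.castRingHom ℂ) levelThreePoly) ∧
    MvPolynomial.degreeOf 0 levelThreePoly = 3 ∧
    MvPolynomial.degreeOf 1 levelThreePoly = 3 := by
  refine ⟨fun τ ↦ ?_, ⟨irreducible_levelThreePoly, fun τ ↦ ?_⟩, degreeOf_zero_levelThreePoly,
    degreeOf_one_levelThreePoly⟩
  · linear_combination wFun_pow_three τ
  · simp only [map_levelThreePoly, map_sub, map_add, map_mul, map_pow, map_one, map_ofNat,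
      MvPolynomial.eval_X, Matrix.cons_val_zero, Matrix.cons_val_one, Nat.cast_ofNat]
    linear_combination wFun_pow_three τ
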